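/- Let $p>2$ be a prime, let $K$ be a finite extension of $\mathbb{Q}_p$ with ring of integers $\mathfrak{o}_v$ and residue field $k_v$, and let $e$ be the ramification index of $K/\mathbb{Q}_p$. Let $\mathcal{X}$ be a flat, separated $\mathfrak{o}_v$-scheme of finite type whose generic fiber is a $K$-variety (that is, an integral separated $K$-scheme of finite type) of dimension $g$, and let $\overline{\mathcal{X}}$ be its special fiber over $k_v$. Assume that there is an $\mathfrak{o}_v$-point $\alpha\in\mathcal{X}(\mathfrak{o}_v)$ that is smooth, i.e. $\mathcal{X}$ is smooth over $\mathfrak{o}_v$ at every point of the image of $\alpha:\operatorname{Spec}\mathfrak{o}_v\to\mathcal{X}$. Let $G$ be a torsion subgroup (every element has finite order) of the group $\operatorname{Aut}(\mathcal{X})$ of automorphisms of $\mathcal{X}$ over $\mathfrak{o}_v$. Then $G$ is finite and $$\#G\le(\#k_v)^{\,g(1+e)\binom{g+e+1}{g}}\cdot\#\mathrm{GL}_g(k_v)\cdot\#\overline{\mathcal{X}}(k_v).$$ -/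

import Mathlib

open CategoryTheory CategoryTheory.Limits AlgebraicGeometry
open scoped NormedField Valued

universe u

noncomputable section

namespace LocalAut

/-! ### The base: the valuation ring of a finite extension of `ℚ_p`

`K` is a finite extension of `ℚ_p` with the norm extending the `p`-adic norm, `𝒪[K]` is its closed
unit ball (the ring of `v`-adic integers) and `𝓀[K]` is the residue field of `𝒪[K]`. -/

section Base

/-- The structure map from the `p`-adic integers to the ring of integers of an extension of the
field of `p`-adic numbers. -/
def padicIntHom (p : ℕ) [Fact p.Prime] (K : Type u) [NontriviallyNormedField K]
    [IsUltrametricDist K] [NormedAlgebra ℚ_[p] K] : ℤ_[p] →+* 𝒪[K] :=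
  ((algebraMap ℚ_[p] K).comp PadicInt.Coe.ringHom).codRestrict (Valued.integer K) fun x => by
    rw [Valued.integer.mem_iff]
    change ‖algebraMap ℚ_[p] K (x : ℚ_[p])‖ ≤ 1
    rw [norm_algebraMap']
    exact PadicInt.norm_le_one x

/-- The ramification index `e` of `K / ℚ_p`. -/
def ramificationIndex (p : ℕ) [Fact p.Prime] (K : Type u) [NontriviallyNormedField K]
    [IsUltrametricDist K] [NormedAlgebra ℚ_[p] K] : ℕ :=
  letI : Algebra ℤ_[p] 𝒪[K] := (padicIntHom p K).toAlgebra
  Ideal.ramificationIdx 𝓂[K] ℤ_[p]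

variable (K : Type u) [NontriviallyNormedField K] [IsUltrametricDist K]

/-- The spectrum of the ring of integers of `K`. -/
abbrev specIntegers : Scheme.{u} := Spec (CommRingCat.of 𝒪[K])

/-- The inclusion of the generic point `Spec K ⟶ Spec 𝒪[K]`. -/
abbrev specFraction : Spec (CommRingCat.of K) ⟶ specIntegers K :=
  Spec.map (CommRingCat.ofHom (Valued.integer K).subtype)

/-- The inclusion of the closed point `Spec 𝓀[K] ⟶ Spec 𝒪[K]`. -/
abbrev specResidue : Spec (CommRingCat.of 𝓀[K]) ⟶ specIntegers K :=
  Spec.map (CommRingCat.ofHom (IsLocalRing.residue 𝒪[K]))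

variable {K}

/-- The generic fiber of an `𝒪[K]`-scheme, as a scheme over `K`. -/
abbrev genericFiber (𝒳 : Over (specIntegers K)) : Over (Spec (CommRingCat.of K)) :=
  Over.mk (pullback.snd 𝒳.hom (specFraction K))

/-- The special fiber of an `𝒪[K]`-scheme, as a scheme over the residue field. -/
abbrev specialFiber (𝒳 : Over (specIntegers K)) : Over (Spec (CommRingCat.of 𝓀[K])) :=
  Over.mk (pullback.snd 𝒳.hom (specResidue K))

end Base

/-- The set `X(S)` of `S`-points of an `S`-scheme `X`, that is, of sections of `X ⟶ S`. -/
abbrev Points {S : Scheme.{u}} (X : Over S) : Type u := Over.mk (𝟙 S) ⟶ X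

/-- A variety over a field `F`: an integral separated scheme of finite type over `F`. -/
structure IsVariety {F : Type u} [Field F] (X : Over (Spec (CommRingCat.of F))) : Prop where
  isIntegral : IsIntegral X.left
  isSeparated : IsSeparated X.hom
  locallyOfFiniteType : LocallyOfFiniteType X.hom
  quasiCompact : QuasiCompact X.hom

/-- The `S`-scheme `X` is smooth over `S` at the point `x`: it is smooth on some open
neighborhood of `x`. -/
def IsSmoothAt {S : Scheme.{u}} (X : Over S) (x : X.left) : Prop :=
  ∃ U : X.left.Opens, x ∈ U ∧ Smooth (U.ι ≫ X.hom)

/-- The `S`-point `α` of `X` is smooth: `X` is smooth over `S` at every point of the image of `α`.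
If `S` is local, this only has to be required at the image of the closed point. -/
def IsSmoothPoint {S : Scheme.{u}} (X : Over S) (α : Points X) : Prop :=
  ∀ s : S, IsSmoothAt X (α.left s)

end LocalAut

end

/-!
Let `R = 𝒪[K]` with uniformizer `ϖ` and residue field `k` with `q` elements, let `x` be the image of
the closed point under the smooth section `α`, and let `A` be the local ring of the scheme at `x`,
with maximal ideal `I`. The group `G` acts on the finite set of `k`-points of the special fibre, so
it suffices to bound the stabilizer `H` of the reduction of `α`
(`finite_and_card_le_of_stabilizer`, `finite_over_hom`). The group `H` fixes `x` and therefore acts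
on `A`. The action is faithful, because the scheme is integral and separated
(`isIntegral_of_isIntegral_pullback`, `exists_faithful_action_stalk`).

Near `x` the scheme is étale over an affine space of some dimension `d`, with coordinates
`t_1, …, t_d` that vanish along `α` (`exists_flat_coordinates`). Hence `I = (ϖ, t_1, …, t_d)`, and by
flatness multiplication by `ϖ` raises the `I`-adic order by exactly one (`mem_pow_of_mul_mem_pow`),
since this holds in the polynomial ring.

The heart of the proof is that an automorphism `σ` of `A` of finite order that is the identity modulo
`I ^ (e + 1)` is the identity (`eq_one_of_isOfFinOrder`). One may assume that `σ` has prime order `ℓ`.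
Put `δ = σ - 1` and suppose that `δ` maps `A` to `I ^ (n + 1)`; then it maps `I ^ j` to `I ^ (n + j)`.
In the expansion `0 = (1 + δ) ^ ℓ - 1 = ℓ δ + ⋯ + δ ^ ℓ` all terms but the first are so deep in the
filtration that `δ` maps `A` to `I ^ (n + 2)`; for `ℓ = p` this is where `n ≥ e` and `p > 2` are used.
Krull's intersection theorem then gives `δ = 0`.

It follows that an element of `H` is determined by the images of `t_1, …, t_d` in `A ⧸ I ^ (e + 1)`,
a ring spanned over `R ⧸ ϖ ^ (e + 1)` by the monomials of degree at most `e` in the `t_i`, and so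
having at most `q ^ ((e + 1) * (d + e).choose d)` elements. Finally `d ≤ g`, by going down along the
flat coordinate map (`le_ringKrullDim_tensorProduct`). The resulting bound does not need the factor
`#GL_g(k)`.
-/

/-! ### Endomorphisms of finite order congruent to the identity -/

section Torsion

variable {A : Type*} [CommRing A] {I : Ideal A} {σ : A →+* A} {n : ℕ}

theorem map_sub_self_mem_pow_add (h : ∀ a, σ a - a ∈ I ^ (n + 1)) {j : ℕ} {a : A}
    (ha : a ∈ I ^ j) : σ a - a ∈ I ^ (n + j) := by
  induction j generalizing a with
  | zero => exact Ideal.pow_le_pow_right (by omega) (h a)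
  | succ j ih =>
    rw [pow_succ'] at ha
    induction ha using Submodule.mul_induction_on' with
    | mem_mul_mem x hx y hy =>
      have hσy : σ y ∈ I ^ j := by
        have := add_mem (Ideal.pow_le_pow_right (by omega) (ih hy)) hy
        rwa [sub_add_cancel] at this
      have : σ (x * y) - x * y = (σ x - x) * σ y + x * (σ y - y) := by
        rw [map_mul]; ring
      rw [this]
      refine add_mem ?_ ?_
      · have := Ideal.mul_mem_mul (h x) hσy
        rwa [← pow_add, add_right_comm] at this
      · have := Ideal.mul_mem_mul hx (ih hy)
        rwa [← pow_succ', add_assoc] at this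
    | add x hx y hy hx' hy' =>
      have : σ (x + y) - (x + y) = (σ x - x) + (σ y - y) := by rw [map_add]; ring
      rw [this]
      exact add_mem hx' hy'

/-- The additive endomorphism `σ - 1`. -/
def subOne (σ : A →+* A) : Module.End ℤ A := σ.toAddMonoidHom.toIntLinearMap - 1

theorem subOne_apply (σ : A →+* A) (a : A) : subOne σ a = σ a - a := rfl

theorem subOne_pow_apply_mem (h : ∀ a, σ a - a ∈ I ^ (n + 1)) (i : ℕ) (a : A) :
    (subOne σ ^ (i + 1)) a ∈ I ^ (n + 1 + i * n) := by
  induction i with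
  | zero => simpa [subOne_apply] using h a
  | succ i ih =>
    rw [pow_succ', Module.End.mul_apply, subOne_apply]
    have := map_sub_self_mem_pow_add h ih
    convert this using 2
    ring

theorem one_add_subOne_pow_apply (σ : A →+* A) (m : ℕ) (a : A) :
    ((1 + subOne σ) ^ m) a = (σ ^ m) a := by
  induction m generalizing a with
  | zero => rfl
  | succ m ih =>
    rw [pow_succ, pow_succ, Module.End.mul_apply, RingHom.mul_def, RingHom.comp_apply, ih]
    congr 1
    simp [subOne_apply]

/-- If `σ ≡ 1` modulo `I ^ (n + 1)` and `σ ^ ℓ = 1`, then expanding `(1 + (σ - 1)) ^ ℓ = 1` shows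
that `ℓ * (σ a - a)` is in `I ^ (n + 2 + e)`, where `I ^ e` contains `ℓ`: the congruence improves by
one step. -/
theorem map_sub_self_mem_pow_succ {ℓ e : ℕ} (hℓ : ℓ.Prime) (hmem : (ℓ : A) ∈ I ^ e)
    (hdiv : ∀ m a, (ℓ : A) * a ∈ I ^ (m + e) → a ∈ I ^ m) (hn : 1 ≤ n)
    (hen : e + 1 ≤ (ℓ - 1) * n) (hσ : σ ^ ℓ = 1) (h : ∀ a, σ a - a ∈ I ^ (n + 1)) (a : A) :
    σ a - a ∈ I ^ (n + 2) := by
  apply hdiv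
  obtain ⟨r, rfl⟩ : ∃ r, ℓ = r + 2 := ⟨ℓ - 2, by have := hℓ.two_le; omega⟩
  have key := one_add_subOne_pow_apply σ (r + 2) a
  rw [hσ, add_comm, (Commute.one_right (subOne σ)).add_pow, LinearMap.sum_apply,
    Finset.sum_range_succ', Finset.sum_range_succ'] at key
  have key2 : ((r + 2 : ℕ) : A) * (σ a - a) = -∑ i ∈ Finset.range (r + 1),
      (((r + 2).choose (i + 2) : ℕ) : A) * (subOne σ ^ (i + 2)) a := by
    have e1 : ∀ i, (subOne σ ^ (i + 1 + 1) * 1 ^ (r + 2 - (i + 1 + 1)) *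
        (((r + 2).choose (i + 1 + 1) : ℕ) : Module.End ℤ A)) a
        = (((r + 2).choose (i + 2) : ℕ) : A) * (subOne σ ^ (i + 2)) a := by
      intro i
      rw [one_pow, mul_one, ← (Nat.cast_commute _ _).eq, Module.End.mul_apply]
      rw [show i + 1 + 1 = i + 2 from rfl, ← nsmul_eq_mul]
      simp
    simp only [e1] at key
    simp only [zero_add, pow_one, one_pow, mul_one, Nat.choose_one_right, pow_zero,
      Nat.choose_zero_right, Nat.cast_one, Module.End.one_apply, RingHom.one_def,
      RingHom.id_apply, add_eq_right] at key
    rw [← (Nat.cast_commute (r + 2) (subOne σ)).eq, Module.End.mul_apply] at key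
    have e2 : (((r + 2 : ℕ) : Module.End ℤ A)) (subOne σ a) = ((r + 2 : ℕ) : A) * (σ a - a) := by
      rw [← nsmul_eq_mul, ← subOne_apply, ← nsmul_one, LinearMap.smul_apply, Module.End.one_apply]
    rw [e2] at key
    exact eq_neg_of_add_eq_zero_right key
  rw [key2]
  refine neg_mem (Ideal.sum_mem _ fun i hi => ?_)
  have hδ := subOne_pow_apply_mem h (i + 1) a
  -- the binomial coefficients are divisible by `ℓ`, except the last one
  rcases Nat.lt_or_ge i r with hir | hir
  · have hd : r + 2 ∣ (r + 2).choose (i + 2) := hℓ.dvd_choose_self (by omega) (by omega)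
    have hc : (((r + 2).choose (i + 2) : ℕ) : A) ∈ I ^ e :=
      Ideal.mem_of_dvd _ (Nat.cast_dvd_cast hd) hmem
    have := Ideal.mul_mem_mul hc hδ
    rw [← pow_add] at this
    refine Ideal.pow_le_pow_right ?_ this
    nlinarith
  · obtain rfl : i = r := by have := Finset.mem_range.1 hi; omega
    refine Ideal.mul_mem_left _ _ (Ideal.pow_le_pow_right ?_ hδ)
    simp only [show i + 2 - 1 = i + 1 from rfl] at hen
    omega

theorem eq_one_of_prime_pow_eq_one {ℓ e : ℕ} (hℓ : ℓ.Prime) (hmem : (ℓ : A) ∈ I ^ e)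
    (hdiv : ∀ m a, (ℓ : A) * a ∈ I ^ (m + e) → a ∈ I ^ m) (hI : ⨅ m, I ^ m = ⊥) (hn : 1 ≤ n)
    (hen : e + 1 ≤ (ℓ - 1) * n) (hσ : σ ^ ℓ = 1) (h : ∀ a, σ a - a ∈ I ^ (n + 1)) : σ = 1 := by
  have key : ∀ r, ∀ a, σ a - a ∈ I ^ (n + r + 1) := by
    intro r
    induction r with
    | zero => exact h
    | succ r ih =>
      exact map_sub_self_mem_pow_succ hℓ hmem hdiv (hn.trans (Nat.le_add_right n r))
        (hen.trans (Nat.mul_le_mul_left _ (Nat.le_add_right n r))) hσ ih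
  ext a
  have : σ a - a ∈ ⨅ m, I ^ m := (Submodule.mem_iInf _).2 fun m =>
    Ideal.pow_le_pow_right (by omega) (key m a)
  rw [hI] at this
  exact sub_eq_zero.1 this

theorem pow_map_sub_self_mem (h : ∀ a, σ a - a ∈ I ^ n) (m : ℕ) (a : A) :
    (σ ^ m) a - a ∈ I ^ n := by
  induction m generalizing a with
  | zero => simp
  | succ m ih =>
    rw [pow_succ, RingHom.mul_def, RingHom.comp_apply]
    simpa using add_mem (ih (σ a)) (h a)

/-- Away from `p`, which has to be invertible, a prime order is handled by the same argument as the
order `p`, with `e = 0`. -/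
theorem eq_one_of_isOfFinOrder {p e : ℕ} (hp : 2 < p) (he : 1 ≤ e)
    (hunit : ∀ ℓ : ℕ, ℓ.Prime → ℓ ≠ p → IsUnit (ℓ : A)) (hmem : (p : A) ∈ I ^ e)
    (hdiv : ∀ m a, (p : A) * a ∈ I ^ (m + e) → a ∈ I ^ m) (hI : ⨅ m, I ^ m = ⊥)
    (hσ : IsOfFinOrder σ) (h : ∀ a, σ a - a ∈ I ^ (e + 1)) : σ = 1 := by
  by_contra hne
  have ho : orderOf σ ≠ 1 := fun h1 => hne (orderOf_eq_one_iff.1 h1)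
  obtain ⟨ℓ, hℓ, k, hk⟩ := Nat.exists_prime_and_dvd ho
  have hpos : 0 < orderOf σ := hσ.orderOf_pos
  have hk0 : k ≠ 0 := by rintro rfl; omega
  have hτ : (σ ^ k) ^ ℓ = 1 := by rw [← pow_mul, mul_comm, ← hk, pow_orderOf_eq_one]
  have hτ1 : σ ^ k = 1 := by
    by_cases hlp : ℓ = p
    · subst hlp
      refine eq_one_of_prime_pow_eq_one hℓ hmem hdiv hI he ?_ hτ (pow_map_sub_self_mem h k)
      obtain ⟨q, rfl⟩ : ∃ q, ℓ = q + 3 := ⟨ℓ - 3, by omega⟩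
      simp only [show q + 3 - 1 = q + 2 from rfl]
      nlinarith
    · refine eq_one_of_prime_pow_eq_one hℓ (e := 0) (by simp) (fun m a ha => ?_) hI he ?_ hτ
        (pow_map_sub_self_mem h k)
      · exact ((I ^ m).unit_mul_mem_iff_mem (hunit ℓ hℓ hlp)).1 ha
      · have := hℓ.two_le
        exact Nat.mul_pos (by omega) he
  have := orderOf_dvd_of_pow_eq_one hτ1
  have h2 := Nat.le_of_dvd (Nat.pos_of_ne_zero hk0) this
  rw [hk] at h2
  have := hℓ.two_le
  nlinarith [Nat.pos_of_ne_zero hk0]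

end Torsion

/-! ### Colon ideals in polynomial rings and along flat maps -/

section Colon

/-- Colon ideals are compatible with flat base change, by the equational criterion for flatness. -/
theorem mem_map_of_mul_mem_map_of_flat {R A : Type*} [CommRing R] [CommRing A] [Algebra R A]
    [Module.Flat R A] {J J' : Ideal R} {r : R} (hr : ∀ x, r * x ∈ J' → x ∈ J) {a : A}
    (ha : algebraMap R A r * a ∈ J'.map (algebraMap R A)) : a ∈ J.map (algebraMap R A) := by
  rw [Ideal.map, ← Ideal.submodule_span_eq, Submodule.mem_span_image_iff_exists_fun] at ha
  obtain ⟨t, htJ, c, hc⟩ := ha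
  have hrel : ∑ i : Option t, (i.elim r fun j => -(j : R)) • (i.elim a c) = 0 := by
    rw [Fintype.sum_option]
    simp only [Option.elim_none, Option.elim_some, neg_smul, Finset.sum_neg_distrib]
    rw [Algebra.smul_def, ← hc, add_neg_eq_zero]
    exact Finset.sum_congr rfl fun i _ => by
      rw [smul_eq_mul, Algebra.smul_def, mul_comm]
  obtain ⟨k, b, y, hy, hb⟩ := Module.Flat.isTrivialRelation_of_sum_smul_eq_zero (R := R) (M := A)
    (f := fun i : Option t => i.elim r fun j => -(j : R)) (x := fun i => i.elim a c) hrel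
  have h0 := hy none
  simp only [Option.elim_none] at h0
  rw [h0]
  refine Ideal.sum_mem _ fun j _ => ?_
  rw [Algebra.smul_def]
  refine Ideal.mul_mem_right _ _ (Ideal.mem_map_of_mem _ (hr _ ?_))
  have hj := hb j
  rw [Fintype.sum_option] at hj
  simp only [Option.elim_none, Option.elim_some, neg_mul, Finset.sum_neg_distrib] at hj
  rw [add_neg_eq_zero.1 hj]
  exact Ideal.sum_mem _ fun i _ => Ideal.mul_mem_right _ _ (htJ i.2)

variable {R : Type*} [CommRing R] {d : ℕ} (ϖ : R)

/-- The ideal `(ϖ, X_1, …, X_d)` of the polynomial ring: for a uniformizer `ϖ`, the maximal ideal of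
the origin of the special fibre of affine space. -/
noncomputable def originIdeal (d : ℕ) : Ideal (MvPolynomial (Fin d) R) :=
  Ideal.span (insert (MvPolynomial.C ϖ) (Set.range MvPolynomial.X))

theorem C_mem_originIdeal : MvPolynomial.C ϖ ∈ originIdeal ϖ d :=
  Ideal.subset_span (Set.mem_insert _ _)

theorem X_mem_originIdeal (i : Fin d) : MvPolynomial.X i ∈ originIdeal ϖ d :=
  Ideal.subset_span (Set.mem_insert_of_mem _ ⟨i, rfl⟩)

theorem monomial_mem_originIdeal_pow (ν : Fin d →₀ ℕ) (c : R) :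
    MvPolynomial.monomial ν c ∈ originIdeal ϖ d ^ ν.degree := by
  rw [MvPolynomial.monomial_eq, Finsupp.prod, Finsupp.degree_apply]
  refine Ideal.mul_mem_left _ _ ?_
  rw [← Finset.prod_pow_eq_pow_sum]
  exact Ideal.prod_mem_prod fun i _ => Ideal.pow_mem_pow (X_mem_originIdeal ϖ i) _

/-- A power of `(ϖ, X_1, …, X_d)` is described by the divisibility of the coefficients. -/
theorem mem_originIdeal_pow_iff {m : ℕ} {f : MvPolynomial (Fin d) R} :
    f ∈ originIdeal ϖ d ^ m ↔ ∀ ν : Fin d →₀ ℕ, ϖ ^ (m - ν.degree) ∣ f.coeff ν := by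
  constructor
  · intro hf
    induction m generalizing f with
    | zero => simp
    | succ m ih =>
      rw [pow_succ'] at hf
      induction hf using Submodule.mul_induction_on' with
      | add x _ y _ hx hy =>
        intro ν
        rw [MvPolynomial.coeff_add]
        exact dvd_add (hx ν) (hy ν)
      | mem_mul_mem x hx y hym =>
        have hy := ih hym
        induction hx using Submodule.span_induction generalizing y with
        | zero => simp
        | add a b _ _ ha hb =>
          intro ν
          rw [add_mul, MvPolynomial.coeff_add]
          exact dvd_add (ha y hym hy ν) (hb y hym hy ν)
        | smul c x _ hx =>
          rw [smul_eq_mul, mul_comm c x, mul_assoc]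
          exact hx (c * y) (Ideal.mul_mem_left _ _ hym) (ih (Ideal.mul_mem_left _ _ hym))
        | mem x hx =>
          intro ν
          rcases hx with rfl | ⟨i, rfl⟩
          · rw [MvPolynomial.coeff_C_mul]
            refine (pow_dvd_pow ϖ (show m + 1 - ν.degree ≤ (m - ν.degree) + 1 by omega)).trans ?_
            rw [pow_succ']
            exact mul_dvd_mul_left _ (hy ν)
          · rw [MvPolynomial.coeff_X_mul']
            split_ifs with hi
            · refine (pow_dvd_pow ϖ ?_).trans (hy _)
              have hle : Finsupp.single i 1 ≤ ν := by
                simpa [Nat.one_le_iff_ne_zero] using hi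
              have := congrArg Finsupp.degree (tsub_add_cancel_of_le hle)
              rw [map_add, Finsupp.degree_single] at this
              omega
            · exact dvd_zero _
  · intro h
    rw [f.as_sum]
    refine Ideal.sum_mem _ fun ν _ => ?_
    obtain ⟨c, hc⟩ := h ν
    rw [hc, ← MvPolynomial.C_mul_monomial, map_pow]
    have := Ideal.mul_mem_mul (Ideal.pow_mem_pow (C_mem_originIdeal (d := d) ϖ) (m - ν.degree))
      (monomial_mem_originIdeal_pow ϖ ν c)
    rw [← pow_add] at this
    exact Ideal.pow_le_pow_right (by omega) this

theorem mem_originIdeal_pow_of_C_mul_mem [IsDomain R] (hϖ : ϖ ≠ 0) {m : ℕ}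
    {f : MvPolynomial (Fin d) R} (hf : MvPolynomial.C ϖ * f ∈ originIdeal ϖ d ^ (m + 1)) :
    f ∈ originIdeal ϖ d ^ m := by
  rw [mem_originIdeal_pow_iff] at hf ⊢
  intro ν
  have := hf ν
  rw [MvPolynomial.coeff_C_mul] at this
  -- in degrees above `m` the truncated exponent is zero, so there is no condition
  rcases le_or_gt ν.degree m with h | h
  · rw [show m + 1 - ν.degree = (m - ν.degree) + 1 by omega, pow_succ'] at this
    exact (mul_dvd_mul_iff_left hϖ).1 this
  · rw [Nat.sub_eq_zero_of_le h.le, pow_zero]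
    exact one_dvd _

/-- In a flat algebra over the polynomial ring, multiplication by `ϖ` raises the order with respect
to the extension of `(ϖ, X_1, …, X_d)` by exactly one. -/
theorem mem_pow_of_mul_mem_pow [IsDomain R] (hϖ : ϖ ≠ 0) {A : Type*} [CommRing A] [Algebra R A]
    [Algebra (MvPolynomial (Fin d) R) A] [IsScalarTower R (MvPolynomial (Fin d) R) A]
    [Module.Flat (MvPolynomial (Fin d) R) A] {I : Ideal A}
    (hI : I = (originIdeal ϖ d).map (algebraMap _ A)) (e : ℕ) {m : ℕ} {a : A}
    (ha : algebraMap R A (ϖ ^ e) * a ∈ I ^ (m + e)) : a ∈ I ^ m := by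
  induction e generalizing a with
  | zero => simpa using ha
  | succ e ih =>
    apply ih
    rw [pow_succ', map_mul, mul_assoc, ← add_assoc, hI, ← Ideal.map_pow,
      IsScalarTower.algebraMap_apply R (MvPolynomial (Fin d) R) A ϖ] at ha
    have := mem_map_of_mul_mem_map_of_flat
      (fun f hf => mem_originIdeal_pow_of_C_mul_mem ϖ hϖ hf) ha
    rwa [Ideal.map_pow, ← hI] at this

end Colon

/-! ### Counting automorphisms modulo a power of the maximal ideal -/

section Count

variable {R : Type*} [CommRing R] {ϖ : R} {d : ℕ}
  {A : Type*} [CommRing A] [Algebra R A] [Algebra (MvPolynomial (Fin d) R) A]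
  [IsScalarTower R (MvPolynomial (Fin d) R) A] {I : Ideal A}

/-- If `R` surjects onto `A ⧸ I`, every element of `A` is congruent to a polynomial in the
coordinates modulo any power of `I`. -/
theorem exists_sub_algebraMap_mem_pow (hI : I = (originIdeal ϖ d).map (algebraMap _ A))
    (hres : ∀ a : A, ∃ r : R, a - algebraMap R A r ∈ I) (m : ℕ) (a : A) :
    ∃ f : MvPolynomial (Fin d) R, a - algebraMap _ A f ∈ I ^ m := by
  induction m with
  | zero => exact ⟨0, by simp⟩
  | succ m ih =>
    have key : ∀ b ∈ I ^ m, ∃ f : MvPolynomial (Fin d) R, b - algebraMap _ A f ∈ I ^ (m + 1) := by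
      intro b hb
      have hb' := hb
      rw [hI, ← Ideal.map_pow, Ideal.map] at hb'
      induction hb' using Submodule.span_induction with
      | mem x hx =>
        obtain ⟨f, -, rfl⟩ := hx
        exact ⟨f, by simp⟩
      | zero => exact ⟨0, by simp⟩
      | add x y hx hy hx' hy' =>
        have hmem : ∀ z ∈ Submodule.span A (algebraMap (MvPolynomial (Fin d) R) A ''
            ↑(originIdeal ϖ d ^ m)), z ∈ I ^ m := fun z hz => by
          rw [hI, ← Ideal.map_pow, Ideal.map]; exact hz
        obtain ⟨f, hf⟩ := hx' (hmem x hx)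
        obtain ⟨f', hf'⟩ := hy' (hmem y hy)
        refine ⟨f + f', ?_⟩
        rw [map_add, add_sub_add_comm]
        exact add_mem hf hf'
      | smul c x hx hx' =>
        have hxm : x ∈ I ^ m := by
          rw [hI, ← Ideal.map_pow, Ideal.map]; exact hx
        obtain ⟨f, hf⟩ := hx' hxm
        obtain ⟨r, hr⟩ := hres c
        refine ⟨algebraMap R _ r * f, ?_⟩
        rw [map_mul, ← IsScalarTower.algebraMap_apply, smul_eq_mul,
          show c * x - algebraMap R A r * algebraMap _ A f =
            (c - algebraMap R A r) * x + algebraMap R A r * (x - algebraMap _ A f) by ring]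
        refine add_mem ?_ (Ideal.mul_mem_left _ _ hf)
        rw [pow_succ']
        exact Ideal.mul_mem_mul hr hxm
    obtain ⟨f, hf⟩ := ih
    obtain ⟨f', hf'⟩ := key _ hf
    exact ⟨f + f', by rwa [map_add, ← sub_sub]⟩

/-- The exponents of the monomials of degree at most `e` in `d` variables. -/
noncomputable def exponentsDegreeLE (d e : ℕ) : Finset (Fin d →₀ ℕ) :=
  (Finset.range (e + 1)).biUnion fun i => Finset.univ.finsuppAntidiag i

theorem mem_exponentsDegreeLE {d e : ℕ} {ν : Fin d →₀ ℕ} :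
    ν ∈ exponentsDegreeLE d e ↔ ν.degree ≤ e := by
  simp [exponentsDegreeLE, Finset.mem_finsuppAntidiag, Finsupp.degree_eq_sum]

theorem card_exponentsDegreeLE_le (d e : ℕ) :
    (exponentsDegreeLE d e).card ≤ (d + e).choose d := by
  refine Finset.card_biUnion_le.trans (le_of_eq ?_)
  simp only [Finset.card_finsuppAntidiag_nat_eq_multichoose, Finset.card_univ, Fintype.card_fin]
  rw [Nat.sum_range_multichoose, Nat.add_comm]

variable [IsDomain R] [IsDiscreteValuationRing R]

theorem natCard_quotient_span_pow (hϖ : Irreducible ϖ) (m : ℕ) :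
    Nat.card (R ⧸ Ideal.span {ϖ ^ m}) = Nat.card (IsLocalRing.ResidueField R) ^ m := by
  have h := cardQuot_pow_of_prime (P := IsLocalRing.maximalIdeal R)
    (IsDiscreteValuationRing.not_a_field R) (i := m)
  rw [hϖ.maximalIdeal_eq, Ideal.span_singleton_pow, ← hϖ.maximalIdeal_eq] at h
  exact h

variable [Finite (IsLocalRing.ResidueField R)]

theorem finite_quotient_span_pow (hϖ : Irreducible ϖ) (m : ℕ) :
    Finite (R ⧸ Ideal.span {ϖ ^ m}) := by
  apply Nat.finite_of_card_ne_zero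
  rw [natCard_quotient_span_pow hϖ]
  exact pow_ne_zero _ Nat.card_pos.ne'

/-- Modulo `I ^ (e + 1)`, every element is a combination of the monomials of degree at most `e` in
the coordinates, with coefficients in `R / ϖ ^ (e + 1)`. -/
theorem finite_quotient_pow_and_card_le (hϖ : Irreducible ϖ)
    (hI : I = (originIdeal ϖ d).map (algebraMap _ A))
    (hres : ∀ a : A, ∃ r : R, a - algebraMap R A r ∈ I) (e : ℕ) :
    Finite (A ⧸ I ^ (e + 1)) ∧ Nat.card (A ⧸ I ^ (e + 1)) ≤
      Nat.card (IsLocalRing.ResidueField R) ^ ((e + 1) * (d + e).choose d) := by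
  classical
  have := finite_quotient_span_pow hϖ (e + 1)
  let Φ : (exponentsDegreeLE d e → R ⧸ Ideal.span {ϖ ^ (e + 1)}) → A ⧸ I ^ (e + 1) := fun c =>
    Ideal.Quotient.mk _ (algebraMap (MvPolynomial (Fin d) R) A
      (∑ ν, MvPolynomial.monomial ν.1 (c ν).out))
  have hΦ : Function.Surjective Φ := by
    intro x
    obtain ⟨a, rfl⟩ := Ideal.Quotient.mk_surjective x
    obtain ⟨f, hf⟩ := exists_sub_algebraMap_mem_pow hI hres (e + 1) a
    refine ⟨fun ν => Ideal.Quotient.mk _ (f.coeff ν.1), ?_⟩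
    rw [eq_comm, Ideal.Quotient.eq]
    have : algebraMap _ A (f - ∑ ν : exponentsDegreeLE d e, MvPolynomial.monomial ν.1
        (Quotient.out (Ideal.Quotient.mk (Ideal.span {ϖ ^ (e + 1)}) (f.coeff ν.1)))) ∈
          I ^ (e + 1) := by
      rw [hI, ← Ideal.map_pow]
      refine Ideal.mem_map_of_mem _ ((mem_originIdeal_pow_iff ϖ).2 fun μ => ?_)
      rw [MvPolynomial.coeff_sub, MvPolynomial.coeff_sum]
      simp only [MvPolynomial.coeff_monomial]
      by_cases hμ : μ ∈ exponentsDegreeLE d e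
      · rw [Finset.sum_eq_single ⟨μ, hμ⟩ (fun b _ hb => if_neg fun h => hb (Subtype.ext h))
          (fun h => absurd (Finset.mem_univ _) h), if_pos rfl]
        refine (pow_dvd_pow ϖ (Nat.sub_le _ _)).trans ?_
        rw [← Ideal.mem_span_singleton, ← Ideal.Quotient.eq]
        exact (Quotient.out_eq _).symm
      · have : ¬ μ.degree ≤ e := fun h => hμ (mem_exponentsDegreeLE.2 h)
        rw [Nat.sub_eq_zero_of_le (by omega), pow_zero]
        exact one_dvd _
    rw [map_sub] at this
    simpa using add_mem hf this
  refine ⟨Finite.of_surjective Φ hΦ, (Nat.card_le_card_of_surjective Φ hΦ).trans ?_⟩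
  rw [Nat.card_fun, natCard_quotient_span_pow hϖ, ← pow_mul,
    Nat.card_eq_fintype_card (α := exponentsDegreeLE d e),
    Fintype.card_coe]
  exact Nat.pow_le_pow_right Nat.card_pos
    (Nat.mul_le_mul_left _ (card_exponentsDegreeLE_le d e))

theorem map_mem_maximalIdeal_pow {A : Type*} [CommRing A] [IsLocalRing A] {H : Type*} [Group H]
    (ρ : H →* (A →+* A)) (h : H) {m : ℕ} {a : A} (ha : a ∈ IsLocalRing.maximalIdeal A ^ m) :
    ρ h a ∈ IsLocalRing.maximalIdeal A ^ m := by
  have hloc : IsLocalHom (ρ h) := ⟨fun x hx => by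
    have h1 : ρ h⁻¹ (ρ h x) = x := by
      rw [← RingHom.comp_apply, ← RingHom.mul_def, ← map_mul, inv_mul_cancel, map_one,
        RingHom.one_def, RingHom.id_apply]
    rw [← h1]
    exact hx.map _⟩
  have h1 := Ideal.mem_map_of_mem (ρ h) ha
  rw [Ideal.map_pow] at h1
  exact Ideal.pow_right_mono (((IsLocalRing.local_hom_TFAE (ρ h)).out 0 2).1 hloc) m h1

/-- A torsion group acting faithfully on a local ring `A` by automorphisms over `R` is determined by
its action on the images of the coordinates in `A ⧸ I ^ (e + 1)`, where `I` is the maximal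
ideal. -/
theorem finite_and_card_le_of_isMulTorsion [IsLocalRing A] [IsNoetherianRing A]
    [Module.Flat (MvPolynomial (Fin d) R) A] {p e : ℕ} (hp : p.Prime) (hp2 : 2 < p) (he : 1 ≤ e)
    (hϖ : Irreducible ϖ) (hpe : ∃ v : Rˣ, (p : R) = ϖ ^ e * v)
    (hI : IsLocalRing.maximalIdeal A = (originIdeal ϖ d).map (algebraMap _ A))
    (hres : ∀ a : A, ∃ r : R, a - algebraMap R A r ∈ IsLocalRing.maximalIdeal A)
    {H : Type*} [Group H] (hH : IsMulTorsion H) (ρ : H →* (A →+* A))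
    (hρ : Function.Injective ρ) (hρR : ∀ h r, ρ h (algebraMap R A r) = algebraMap R A r) :
    Finite H ∧ Nat.card H ≤
      Nat.card (IsLocalRing.ResidueField R) ^ (d * (e + 1) * (d + e).choose d) := by
  obtain ⟨hfin, hcard⟩ := finite_quotient_pow_and_card_le hϖ hI hres e
  set I := IsLocalRing.maximalIdeal A with hIdef
  obtain ⟨v, hv⟩ := hpe
  have hϖI : algebraMap R A ϖ ∈ I := by
    rw [hI, IsScalarTower.algebraMap_apply R (MvPolynomial (Fin d) R) A]
    exact Ideal.mem_map_of_mem _ (C_mem_originIdeal ϖ)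
  have hpA : (p : A) = algebraMap R A v * algebraMap R A (ϖ ^ e) := by
    rw [← map_mul, mul_comm, ← hv, map_natCast]
  have hpI : (p : A) ∈ I ^ e := by
    rw [hpA, map_pow]
    exact Ideal.mul_mem_left _ _ (Ideal.pow_mem_pow hϖI e)
  have hdiv : ∀ m a, (p : A) * a ∈ I ^ (m + e) → a ∈ I ^ m := by
    intro m a ha
    rw [hpA, mul_assoc] at ha
    exact mem_pow_of_mul_mem_pow ϖ hϖ.ne_zero hI e
      (((I ^ (m + e)).unit_mul_mem_iff_mem (v.isUnit.map (algebraMap R A))).1 ha)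
  -- the residue characteristic is `p`
  have hunit : ∀ ℓ : ℕ, ℓ.Prime → ℓ ≠ p → IsUnit (ℓ : A) := by
    intro ℓ hℓ hne
    by_contra hnu
    have h1 : (ℓ : A) ∈ I := hnu
    have h2 : (p : A) ∈ I := Ideal.pow_le_self (by omega) hpI
    have hcop : IsCoprime (ℓ : ℤ) (p : ℤ) :=
      Nat.isCoprime_iff_coprime.2 ((Nat.coprime_primes hℓ hp).2 hne)
    obtain ⟨a, b, hab⟩ := hcop.map (Int.castRingHom A)
    refine (Ideal.ne_top_iff_one I).1 (IsLocalRing.maximalIdeal.isMaximal A).ne_top ?_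
    rw [← hab]
    simpa using add_mem (Ideal.mul_mem_left _ a h1) (Ideal.mul_mem_left _ b h2)
  have hKrull : ⨅ m, I ^ m = ⊥ :=
    Ideal.iInf_pow_eq_bot_of_isLocalRing I (IsLocalRing.maximalIdeal.isMaximal A).ne_top
  -- two elements with the same image under `Ψ` agree modulo `I ^ (e + 1)` on all of `A`, because
  -- polynomials in the coordinates represent all classes
  let Ψ : H → Fin d → A ⧸ I ^ (e + 1) := fun h i =>
    Ideal.Quotient.mk _ (ρ h (algebraMap (MvPolynomial (Fin d) R) A (MvPolynomial.X i)))
  have hΨ : Function.Injective Ψ := by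
    intro h h' hh
    have hP : ((Ideal.Quotient.mk (I ^ (e + 1))).comp (ρ h)).comp
          (algebraMap (MvPolynomial (Fin d) R) A) =
        ((Ideal.Quotient.mk (I ^ (e + 1))).comp (ρ h')).comp
          (algebraMap (MvPolynomial (Fin d) R) A) := by
      refine MvPolynomial.ringHom_ext (fun r => ?_) fun i => congrFun hh i
      have : algebraMap (MvPolynomial (Fin d) R) A (MvPolynomial.C r) = algebraMap R A r :=
        (IsScalarTower.algebraMap_apply R (MvPolynomial (Fin d) R) A r).symm
      simp [this, hρR]
    have hclose : ∀ a, ρ h a - ρ h' a ∈ I ^ (e + 1) := by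
      intro a
      obtain ⟨f, hf⟩ := exists_sub_algebraMap_mem_pow hI hres (e + 1) a
      have h1 := map_mem_maximalIdeal_pow ρ h hf
      have h2 := map_mem_maximalIdeal_pow ρ h' hf
      have h3 := Ideal.Quotient.eq.1 (RingHom.congr_fun hP f)
      rw [map_sub] at h1 h2
      have := add_mem (sub_mem h1 h2) h3
      convert this using 1
      ring
    have h1 : ρ (h'⁻¹ * h) = 1 := by
      refine eq_one_of_isOfFinOrder hp2 he hunit hpI hdiv hKrull
        (MonoidHom.isOfFinOrder ρ (hH _)) fun a => ?_
      have h2 := map_mem_maximalIdeal_pow ρ h'⁻¹ (hclose a)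
      rw [map_sub] at h2
      have h3 : ρ h'⁻¹ (ρ h' a) = a := by
        rw [← RingHom.comp_apply, ← RingHom.mul_def, ← map_mul, inv_mul_cancel, map_one,
          RingHom.one_def, RingHom.id_apply]
      rw [h3] at h2
      rwa [map_mul, RingHom.mul_def, RingHom.comp_apply]
    have h2 : h'⁻¹ * h = 1 := hρ (by rw [h1, map_one])
    rw [inv_mul_eq_one] at h2
    exact h2.symm
  refine ⟨Finite.of_injective Ψ hΨ, (Nat.card_le_card_of_injective Ψ hΨ).trans ?_⟩
  rw [Nat.card_fun, Nat.card_eq_fintype_card (α := Fin d), Fintype.card_fin]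
  refine (Nat.pow_le_pow_left hcard d).trans (le_of_eq ?_)
  rw [← pow_mul]
  congr 1
  ring

end Count

/-! ### The ring of integers -/

section Base

open LocalAut

variable (p : ℕ) [Fact p.Prime] (K : Type u) [NontriviallyNormedField K] [IsUltrametricDist K]
  [NormedAlgebra ℚ_[p] K]

theorem compactSpace_integers [FiniteDimensional ℚ_[p] K] : CompactSpace 𝒪[K] := by
  have : ProperSpace K := FiniteDimensional.proper ℚ_[p] K
  rw [← isCompact_univ_iff, Subtype.isCompact_iff, Set.image_univ, Subtype.range_coe_subtype]
  convert isCompact_closedBall (0 : K) 1 using 1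
  ext x
  simpa using Valued.integer.mem_iff

theorem isDiscreteValuationRing_integers [FiniteDimensional ℚ_[p] K] :
    IsDiscreteValuationRing 𝒪[K] := by
  have := compactSpace_integers p K
  have : (Valued.v : Valuation K NNReal).IsNontrivial :=
    inferInstanceAs (NormedField.valuation (K := K)).IsNontrivial
  exact Valued.integer.isDiscreteValuationRing_of_compactSpace

theorem finite_residueField_integers [FiniteDimensional ℚ_[p] K] : Finite 𝓀[K] := by
  have hc := compactSpace_integers p K
  have : (Valued.v : Valuation K NNReal).RankOne :=
    inferInstanceAs (NormedField.valuation (K := K)).RankOne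
  exact (Valued.integer.compactSpace_iff_completeSpace_and_isDiscreteValuationRing_and_finite_residueField.1
    hc).2.2

theorem norm_natCast_prime_lt_one : ‖((p : 𝒪[K]) : K)‖ < 1 := by
  have : ((p : 𝒪[K]) : K) = algebraMap ℚ_[p] K p := by simp
  rw [this, norm_algebraMap']
  exact Padic.norm_p_lt_one

theorem natCast_prime_mem_maximalIdeal : (p : 𝒪[K]) ∈ 𝓂[K] := by
  rw [IsLocalRing.mem_maximalIdeal, mem_nonunits_iff, Valued.integer.isUnit_iff_norm_eq_one]
  exact (norm_natCast_prime_lt_one p K).ne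

theorem natCast_prime_ne_zero : (p : 𝒪[K]) ≠ 0 := by
  intro h
  have h1 : ((p : 𝒪[K]) : K) = algebraMap ℚ_[p] K p := by simp
  rw [h] at h1
  have h2 : (p : ℚ_[p]) = 0 := (map_eq_zero (algebraMap ℚ_[p] K)).1 (by simpa using h1.symm)
  exact (Fact.out : p.Prime).ne_zero (by exact_mod_cast h2)

/-- The ramification index, defined as the length of `𝒪[K] ⧸ p`, is the exponent of the uniformizer
in `p`. -/
theorem ramificationIndex_spec [FiniteDimensional ℚ_[p] K] {ϖ : 𝒪[K]} (hϖ : Irreducible ϖ) :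
    1 ≤ ramificationIndex p K ∧ ∃ v : 𝒪[K]ˣ, (p : 𝒪[K]) = ϖ ^ ramificationIndex p K * v := by
  have := isDiscreteValuationRing_integers p K
  let _ : Algebra ℤ_[p] 𝒪[K] := (padicIntHom p K).toAlgebra
  obtain ⟨n, v, hv⟩ := IsDiscreteValuationRing.eq_unit_mul_pow_irreducible
    (natCast_prime_ne_zero p K) hϖ
  have hmax : 𝓂[K] = Ideal.span {ϖ} := hϖ.maximalIdeal_eq
  have hmap : (IsLocalRing.maximalIdeal ℤ_[p]).map (algebraMap ℤ_[p] 𝒪[K]) = 𝓂[K] ^ n := by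
    rw [PadicInt.maximalIdeal_eq_span_p, Ideal.map_span, Set.image_singleton, map_natCast, hv,
      hmax, Ideal.span_singleton_pow, mul_comm,
      Ideal.span_singleton_mul_right_unit v.isUnit]
  have hlies : Ideal.LiesOver 𝓂[K] (IsLocalRing.maximalIdeal ℤ_[p]) := by
    refine ⟨(IsLocalRing.maximalIdeal.isMaximal ℤ_[p]).eq_of_le
      (Ideal.IsPrime.under _ _).ne_top ?_⟩
    rw [PadicInt.maximalIdeal_eq_span_p, Ideal.span_singleton_le_iff_mem, Ideal.mem_comap,
      map_natCast]
    exact natCast_prime_mem_maximalIdeal p K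
  have hne : (IsLocalRing.maximalIdeal ℤ_[p]).map (algebraMap ℤ_[p] 𝒪[K]) ≠ ⊥ := by
    rw [hmap]
    exact pow_ne_zero _ (IsDiscreteValuationRing.not_a_field _)
  have he : ramificationIndex p K = n := by
    have h1 := Ideal.ramificationIdx'_eq_ramificationIdx' (R := ℤ_[p]) (S := 𝒪[K])
      (IsLocalRing.maximalIdeal ℤ_[p]) 𝓂[K] hne
    change Ideal.ramificationIdx 𝓂[K] ℤ_[p] = n
    rw [← h1]
    refine Ideal.ramificationIdx'_spec hmap.le fun h => ?_
    rw [hmap, hmax, Ideal.span_singleton_pow, Ideal.span_singleton_pow,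
      Ideal.span_singleton_le_span_singleton] at h
    exact absurd ((pow_dvd_pow_iff hϖ.ne_zero hϖ.not_isUnit).1 h) (by omega)
  refine ⟨?_, v, by rw [he, hv, mul_comm]⟩
  rw [he, Nat.one_le_iff_ne_zero]
  rintro rfl
  have := natCast_prime_mem_maximalIdeal p K
  rw [hv, pow_zero, mul_one] at this
  exact this v.isUnit

end Base

/-! ### Étale coordinates at a section -/

section Coordinates

theorem mem_originIdeal_iff {R : Type*} [CommRing R] {ϖ : R} {d : ℕ}
    {f : MvPolynomial (Fin d) R} : f ∈ originIdeal ϖ d ↔ ϖ ∣ f.constantCoeff := by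
  rw [← pow_one (originIdeal ϖ d), mem_originIdeal_pow_iff]
  constructor
  · intro h
    simpa [MvPolynomial.constantCoeff_eq] using h 0
  · intro h ν
    by_cases hν : ν = 0
    · simpa [hν, MvPolynomial.constantCoeff_eq] using h
    · have : ν.degree ≠ 0 := fun h0 => hν ((Finsupp.degree_eq_zero_iff ν).1 h0)
      rw [Nat.sub_eq_zero_of_le (by omega), pow_zero]
      exact one_dvd _

theorem originIdeal_isMaximal {R : Type*} [CommRing R] [IsDomain R] [IsDiscreteValuationRing R]
    {ϖ : R} (hϖ : Irreducible ϖ) (d : ℕ) : (originIdeal ϖ d).IsMaximal := by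
  have h : originIdeal ϖ d = (IsLocalRing.maximalIdeal R).comap MvPolynomial.constantCoeff := by
    ext f
    rw [mem_originIdeal_iff, Ideal.mem_comap, hϖ.maximalIdeal_eq, Ideal.mem_span_singleton]
  rw [h]
  exact Ideal.comap_isMaximal_of_surjective _ fun r =>
    ⟨MvPolynomial.C r, MvPolynomial.constantCoeff_C _ r⟩

/-- An unramified local algebra essentially of finite type: the maximal ideal is extended from the
base. -/
theorem map_eq_maximalIdeal_of_formallyUnramified {P A : Type*} [CommRing P] [CommRing A]
    [IsLocalRing A] [Algebra P A] [Algebra.EssFiniteType P A] [Algebra.FormallyUnramified P A]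
    {J : Ideal P} (hJ : J.IsMaximal)
    (hle : J ≤ (IsLocalRing.maximalIdeal A).comap (algebraMap P A)) :
    J.map (algebraMap P A) = IsLocalRing.maximalIdeal A := by
  have hcomap : J = (IsLocalRing.maximalIdeal A).comap (algebraMap P A) :=
    hJ.eq_of_le (Ideal.comap_ne_top _ (IsLocalRing.maximalIdeal.isMaximal A).ne_top) hle
  have hunits : ∀ y : J.primeCompl, IsUnit (algebraMap P A y) := by
    rintro ⟨y, hy⟩
    by_contra h
    exact hy (by rw [hcomap]; exact h)
  let P' := Localization.AtPrime J
  let _ : Algebra P' A := (IsLocalization.lift (M := J.primeCompl) (S := P') hunits).toAlgebra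
  have : IsScalarTower P P' A := .of_algebraMap_eq' (IsLocalization.lift_comp hunits).symm
  have : Algebra.EssFiniteType P' A := .of_comp P _ _
  have : Algebra.FormallyUnramified P' A := .of_restrictScalars P _ _
  have : IsLocalHom (algebraMap P' A) := by
    refine ((IsLocalRing.local_hom_TFAE (algebraMap P' A)).out 0 2).2 ?_
    rw [← Localization.AtPrime.map_eq_maximalIdeal, Ideal.map_map, ← IsScalarTower.algebraMap_eq]
    exact Ideal.map_le_iff_le_comap.2 hle
  rw [← Algebra.FormallyUnramified.map_maximalIdeal (R := P') (S := A),
    ← Localization.AtPrime.map_eq_maximalIdeal, Ideal.map_map, ← IsScalarTower.algebraMap_eq]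

/-- The étale coordinates of a standard smooth algebra can be translated so that they vanish along
a given section `ε`. -/
theorem exists_flat_coordinates {R B A : Type u} [CommRing R] [IsDomain R]
    [IsDiscreteValuationRing R] {ϖ : R} (hϖ : Irreducible ϖ) [CommRing B] [CommRing A]
    [IsLocalRing A] [Algebra R A] [Algebra B A] (q : Ideal B) [q.IsPrime]
    [IsLocalization.AtPrime A q] {d : ℕ} (φ : MvPolynomial (Fin d) R →+* B) (hφ : φ.Etale)
    (hφR : ((algebraMap B A).comp φ).comp MvPolynomial.C = algebraMap R A)
    (ε : A →+* R) (hε : ε.comp (algebraMap R A) = RingHom.id R) :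
    IsNoetherianRing A ∧ ∃ ψ : MvPolynomial (Fin d) R →+* A, ψ.comp MvPolynomial.C = algebraMap R A ∧
      ψ.Flat ∧ IsLocalRing.maximalIdeal A = (originIdeal ϖ d).map ψ ∧
      ∀ i, ε (ψ (MvPolynomial.X i)) = 0 := by
  let c : Fin d → R := fun i => ε (algebraMap B A (φ (MvPolynomial.X i)))
  -- the translation by the values of the coordinates along `ε`
  let τ : MvPolynomial (Fin d) R ≃ₐ[R] MvPolynomial (Fin d) R := AlgEquiv.ofAlgHom
    (MvPolynomial.aeval fun i => MvPolynomial.X i - MvPolynomial.C (c i))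
    (MvPolynomial.aeval fun i => MvPolynomial.X i + MvPolynomial.C (c i))
    (by ext i; simp [MvPolynomial.algHom_C]) (by ext i; simp [MvPolynomial.algHom_C])
  have hτ : ∀ i, τ (MvPolynomial.X i) = MvPolynomial.X i - MvPolynomial.C (c i) := fun i => by
    simp [τ]
  have hφτ : (φ.comp τ.toRingEquiv.toRingHom).Etale :=
    RingHom.Etale.respectsIso.2 φ τ.toRingEquiv hφ
  let _ : Algebra (MvPolynomial (Fin d) R) B := (φ.comp τ.toRingEquiv.toRingHom).toAlgebra
  have : Algebra.Etale (MvPolynomial (Fin d) R) B := hφτ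
  let ψ : MvPolynomial (Fin d) R →+* A := (algebraMap B A).comp (φ.comp τ.toRingEquiv.toRingHom)
  let _ : Algebra (MvPolynomial (Fin d) R) A := ψ.toAlgebra
  have : IsScalarTower (MvPolynomial (Fin d) R) B A := .of_algebraMap_eq' rfl
  have : IsNoetherianRing B := Algebra.FiniteType.isNoetherianRing (MvPolynomial (Fin d) R) B
  have : Module.Flat B A := IsLocalization.flat A q.primeCompl
  have : Algebra.FormallyUnramified B A := .of_isLocalization q.primeCompl
  have : Algebra.EssFiniteType B A := .of_isLocalization A q.primeCompl
  have hψC : ψ.comp MvPolynomial.C = algebraMap R A := by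
    rw [← hφR]
    ext r
    simp only [ψ, RingHom.comp_apply]
    congr 2
    exact τ.commutes r
  have hψX : ∀ i, ε (ψ (MvPolynomial.X i)) = 0 := by
    intro i
    have h1 : ψ (MvPolynomial.X i) =
        algebraMap B A (φ (MvPolynomial.X i)) - algebraMap R A (c i) := by
      rw [← hφR]
      simp only [ψ, RingHom.comp_apply, ← map_sub]
      congr 2
      exact hτ i
    rw [h1, map_sub, show ε (algebraMap R A (c i)) = c i from RingHom.congr_fun hε _]
    exact sub_self _
  have hnonunit : ∀ a, ¬ IsUnit (ε a) → a ∈ IsLocalRing.maximalIdeal A :=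
    fun a ha hu => ha (hu.map ε)
  refine ⟨IsLocalization.isNoetherianRing q.primeCompl A inferInstance, ψ, hψC, ?_, ?_, hψX⟩
  · exact Module.Flat.trans (MvPolynomial (Fin d) R) B A
  · have : Algebra.FormallyUnramified (MvPolynomial (Fin d) R) A := .comp _ B _
    have : Algebra.EssFiniteType (MvPolynomial (Fin d) R) A := .comp _ B _
    refine (map_eq_maximalIdeal_of_formallyUnramified (originIdeal_isMaximal hϖ d) ?_).symm
    rw [originIdeal, Ideal.span_le]
    rintro _ (rfl | ⟨i, rfl⟩)
    · refine hnonunit _ ?_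
      change ¬ IsUnit (ε ((ψ.comp MvPolynomial.C) ϖ))
      rw [hψC, ← RingHom.comp_apply, hε]
      exact hϖ.not_isUnit
    · refine hnonunit _ ?_
      change ¬ IsUnit (ε (ψ (MvPolynomial.X i)))
      rw [hψX]
      exact not_isUnit_zero

/-! ### The dimension of the generic fibre at a section -/

/-- The ideal of the origin of affine `d`-space over a domain has height at least `d`: the
coordinate subspaces form a chain of primes. -/
theorem le_height_ker_constantCoeff {R : Type*} [CommRing R] [IsDomain R] (d : ℕ) :
    (d : ℕ∞) ≤ (RingHom.ker (MvPolynomial.constantCoeff (σ := Fin d) (R := R))).height := by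
  classical
  -- the prime of the subspace on which the first `j` coordinates vanish
  let f : ℕ → MvPolynomial (Fin d) R →ₐ[R] MvPolynomial (Fin d) R := fun j =>
    MvPolynomial.aeval fun i => if i.1 < j then 0 else MvPolynomial.X i
  have hcomp : ∀ i j, i ≤ j → (f j).comp (f i) = f j := by
    intro i j hij
    refine MvPolynomial.algHom_ext fun k => ?_
    simp only [f, AlgHom.comp_apply, MvPolynomial.aeval_X]
    split_ifs with h1 h2 h3
    · simp
    · omega
    · simp [h3]
    · simp [h3]
  let s : LTSeries (PrimeSpectrum (MvPolynomial (Fin d) R)) := LTSeries.mk d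
    (fun j => ⟨RingHom.ker (f j), RingHom.ker_isPrime _⟩) (by
      intro i j hij
      refine lt_of_le_of_ne (fun x hx => ?_) fun h => ?_
      · change f j x = 0
        rw [← hcomp i j hij.le, AlgHom.comp_apply, show f i x = 0 from hx, map_zero]
      · have hi : i.1 < d := by have := j.2; have : i.1 < j.1 := hij; omega
        have h1 : MvPolynomial.X ⟨i.1, hi⟩ ∈ RingHom.ker (f j) := by
          rw [RingHom.mem_ker]
          simp only [f, MvPolynomial.aeval_X]
          exact if_pos hij
        have hker : RingHom.ker (f i) = RingHom.ker (f j) := PrimeSpectrum.ext_iff.1 h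
        rw [← hker, RingHom.mem_ker] at h1
        simp only [f, MvPolynomial.aeval_X, lt_irrefl, if_false] at h1
        exact MvPolynomial.X_ne_zero _ h1)
  have hlast : s.last.asIdeal =
      RingHom.ker (MvPolynomial.constantCoeff (σ := Fin d) (R := R)) := by
    have hfd : (f d : MvPolynomial (Fin d) R →+* MvPolynomial (Fin d) R) =
        MvPolynomial.C.comp MvPolynomial.constantCoeff := by
      refine MvPolynomial.ringHom_ext (fun r => ?_) fun i => ?_
      · simp [f, MvPolynomial.algHom_C]
      · simp [f]
    ext x
    change f d x = 0 ↔ MvPolynomial.constantCoeff x = 0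
    rw [show f d x = MvPolynomial.C (MvPolynomial.constantCoeff x) from RingHom.congr_fun hfd x,
      MvPolynomial.C_eq_zero]
  rw [← hlast, PrimeSpectrum.height_eq_orderHeight]
  exact Order.length_le_height_last (p := s)

/-- If `A` is flat over a polynomial ring in `d` variables, all of which vanish under a retraction
`ε : A → R`, then the dimension of the generic fibre of `A` is at least `d`. -/
theorem le_ringKrullDim_tensorProduct {R F A : Type*} [CommRing R] [IsDomain R]
    [IsNoetherianRing R] [Field F]
    [Algebra R F] [IsFractionRing R F] [CommRing A] [Algebra R A] [IsNoetherianRing A] {d : ℕ}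
    (ψ : MvPolynomial (Fin d) R →+* A) (hψC : ψ.comp MvPolynomial.C = algebraMap R A)
    (hψ : ψ.Flat) (ε : A →+* R) (hε : ε.comp (algebraMap R A) = RingHom.id R)
    (hεX : ∀ i, ε (ψ (MvPolynomial.X i)) = 0) :
    (d : WithBot ℕ∞) ≤ ringKrullDim (TensorProduct R A F) := by
  let _ : Algebra (MvPolynomial (Fin d) R) A := ψ.toAlgebra
  have : Module.Flat (MvPolynomial (Fin d) R) A := hψ
  have hprime : (RingHom.ker (MvPolynomial.constantCoeff (σ := Fin d) (R := R))).IsPrime :=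
    RingHom.ker_isPrime _
  have hprime' : (RingHom.ker ε).IsPrime := RingHom.ker_isPrime _
  have hεψ : ε.comp ψ = MvPolynomial.constantCoeff := by
    refine MvPolynomial.ringHom_ext (fun r => ?_) fun i => ?_
    · rw [RingHom.comp_apply, ← RingHom.comp_apply ψ, hψC, ← RingHom.comp_apply, hε]
      simp
    · simp [hεX]
  have hlies : (RingHom.ker ε).LiesOver
      (RingHom.ker (MvPolynomial.constantCoeff (σ := Fin d) (R := R))) :=
    ⟨by rw [← hεψ, ← RingHom.comap_ker]; rfl⟩
  have hheight : (d : ℕ∞) ≤ (RingHom.ker ε).height := by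
    rw [Ideal.height_eq_height_add_of_liesOver_of_hasGoingDown
      (RingHom.ker (MvPolynomial.constantCoeff (σ := Fin d) (R := R))) (RingHom.ker ε)]
    exact (le_height_ker_constantCoeff d).trans le_self_add
  -- `ker ε` survives in the localization `A ⊗ F`, as it contains no nonzero element of `R`
  let M := Algebra.algebraMapSubmonoid A (nonZeroDivisors R)
  have hloc : IsLocalization M (TensorProduct R A F) := inferInstance
  have hdisj : Disjoint (M : Set A) (RingHom.ker ε : Set A) := by
    rw [Set.disjoint_left]
    rintro _ ⟨r, hr, rfl⟩ h
    have : ε.comp (algebraMap R A) r = 0 := h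
    rw [hε] at this
    exact nonZeroDivisors.ne_zero hr this
  have hp := IsLocalization.isPrime_of_isPrime_disjoint M (TensorProduct R A F) _ hprime' hdisj
  rw [← IsLocalization.height_map_of_disjoint (S := TensorProduct R A F) M _ hdisj] at hheight
  exact (WithBot.coe_le_coe.2 hheight).trans (Ideal.height_le_ringKrullDim_of_ne_top hp.ne_top)

end Coordinates

/-! ### The action of endomorphisms on the local ring at a fixed point -/

section Stalk

/-- On an integral scheme, an endomorphism over a separated base that is the identity on the local
scheme of a point is the identity. -/
theorem eq_id_of_fromSpecStalk_comp_eq {X S : Scheme.{u}} [IsIntegral X] (f : X ⟶ S)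
    [IsSeparated f] (σ : X ⟶ X) (hσ : σ ≫ f = f) (x : X)
    (h : X.fromSpecStalk x ≫ σ = X.fromSpecStalk x) : σ = 𝟙 X := by
  obtain ⟨U, hxU, hU⟩ := spread_out_unique_of_isGermInjective' (x := x) σ (𝟙 X) (by simpa using h)
  have : IsDominant U.ι := ⟨by
    rw [DenseRange, Scheme.Opens.range_ι]
    exact U.isOpen.dense ⟨x, hxU⟩⟩
  exact ext_of_isDominant_of_isSeparated f (by simpa using hσ) U.ι hU

theorem exists_specMap_fromSpecStalk_eq {X : Scheme.{u}} (σ : X ⟶ X) {x : X} (hx : σ x = x) :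
    ∃ φ : X.presheaf.stalk x ⟶ X.presheaf.stalk x,
      Spec.map φ ≫ X.fromSpecStalk x = X.fromSpecStalk x ≫ σ := by
  refine ⟨X.presheaf.stalkSpecializes (specializes_of_eq hx) ≫ σ.stalkMap x, ?_⟩
  rw [Spec.map_comp, Category.assoc, Scheme.SpecMap_stalkSpecializes_fromSpecStalk,
    Scheme.SpecMap_stalkMap_fromSpecStalk]

theorem eq_of_specMap_fromSpecStalk_eq {X : Scheme.{u}} {x : X} {R : CommRingCat.{u}}
    {φ φ' : X.presheaf.stalk x ⟶ R}
    (h : Spec.map φ ≫ X.fromSpecStalk x = Spec.map φ' ≫ X.fromSpecStalk x) : φ = φ' :=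
  Spec.map_injective ((cancel_mono (X.fromSpecStalk x)).1 h)

/-- The structure map of the local ring at a point of a scheme over an affine base. -/
noncomputable def stalkStructureMap {X : Scheme.{u}} {R : CommRingCat.{u}} (f : X ⟶ Spec R)
    (x : X) : R ⟶ X.presheaf.stalk x :=
  Spec.preimage (X.fromSpecStalk x ≫ f)

theorem specMap_stalkStructureMap {X : Scheme.{u}} {R : CommRingCat.{u}} (f : X ⟶ Spec R)
    (x : X) : Spec.map (stalkStructureMap f x) = X.fromSpecStalk x ≫ f :=
  Spec.map_preimage _

theorem specMap_ΓSpecIso_inv_appLE {X : Scheme.{u}} {R : CommRingCat.{u}} (f : X ⟶ Spec R)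
    {U : X.Opens} (hU : IsAffineOpen U) (hle : U ≤ f ⁻¹ᵁ ⊤) :
    Spec.map ((Scheme.ΓSpecIso R).inv ≫ f.appLE ⊤ U hle) = hU.fromSpec ≫ f := by
  rw [Spec.map_comp, ← IsAffineOpen.SpecMap_appLE_fromSpec f (isAffineOpen_top _) hU hle,
    IsAffineOpen.fromSpec_top, Scheme.isoSpec_Spec_inv]

theorem specMap_appLE_comp_germ {X : Scheme.{u}} {R : CommRingCat.{u}} (f : X ⟶ Spec R)
    {U : X.Opens} (hU : IsAffineOpen U) {x : X} (hxU : x ∈ U) (hle : U ≤ f ⁻¹ᵁ ⊤) :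
    ((Scheme.ΓSpecIso R).inv ≫ f.appLE ⊤ U hle) ≫ X.presheaf.germ U x hxU =
      stalkStructureMap f x := by
  apply Spec.map_injective
  rw [specMap_stalkStructureMap, Spec.map_comp, specMap_ΓSpecIso_inv_appLE f hU,
    ← hU.fromSpecStalk_eq_fromSpecStalk hxU, IsAffineOpen.fromSpecStalk, Category.assoc]

/-- A group of automorphisms of a separated integral scheme `X` fixing a point `x` acts faithfully
on the local ring at `x`, by automorphisms over the base. -/
theorem exists_faithful_action_stalk {R : CommRingCat.{u}} (X : Over (Spec R)) [IsIntegral X.left]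
    [IsSeparated X.hom] {x : X.left} {H : Type*} [Group H] (θ : H →* Aut X)
    (hθ : Function.Injective θ) (hH : ∀ σ, (θ σ).hom.left x = x) :
    ∃ ρ : H →* (X.left.presheaf.stalk x →+* X.left.presheaf.stalk x), Function.Injective ρ ∧
      ∀ σ r, ρ σ ((stalkStructureMap X.hom x).hom r) = (stalkStructureMap X.hom x).hom r := by
  choose φ hφ using fun σ : H => exists_specMap_fromSpecStalk_eq (θ σ).hom.left (hH σ)
  have hone : φ 1 = 𝟙 _ := eq_of_specMap_fromSpecStalk_eq <| by
    have : (θ 1).hom.left = 𝟙 X.left := by rw [map_one]; rfl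
    rw [hφ, this, Spec.map_id, Category.id_comp, Category.comp_id]
  have hmul : ∀ σ τ, φ (σ * τ) = φ σ ≫ φ τ := fun σ τ => eq_of_specMap_fromSpecStalk_eq <| by
    have : (θ (σ * τ)).hom.left = (θ τ).hom.left ≫ (θ σ).hom.left := by rw [map_mul]; rfl
    rw [hφ, this, Spec.map_comp, Category.assoc, hφ σ, ← Category.assoc, ← hφ τ, Category.assoc]
  -- inverses turn the contravariant action on functions into a left action
  let ρ : H →* (X.left.presheaf.stalk x →+* X.left.presheaf.stalk x) :=
    { toFun := fun σ => (φ σ⁻¹).hom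
      map_one' := by rw [inv_one, hone]; rfl
      map_mul' := fun σ τ => by rw [mul_inv_rev, hmul]; rfl }
  refine ⟨ρ, (injective_iff_map_eq_one ρ).2 fun σ hσ => ?_, fun σ r => ?_⟩
  · have h1 : φ σ⁻¹ = 𝟙 _ := CommRingCat.hom_ext hσ
    have h2 := hφ σ⁻¹
    rw [h1, Spec.map_id, Category.id_comp] at h2
    have h3 := eq_id_of_fromSpecStalk_comp_eq X.hom _ (Over.w _) x h2.symm
    have h4 : θ σ⁻¹ = 1 := Iso.ext (Over.OverMorphism.ext h3)
    exact inv_eq_one.1 (hθ (h4.trans (map_one θ).symm))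
  · have h1 : stalkStructureMap X.hom x ≫ φ σ⁻¹ = stalkStructureMap X.hom x := by
      apply Spec.map_injective
      rw [Spec.map_comp, specMap_stalkStructureMap, ← Category.assoc, hφ, Category.assoc, Over.w]
    exact congrArg (fun ψ => ψ.hom r) h1

/-- A section through `x` retracts the structure map of the local ring at `x`. -/
theorem stalkStructureMap_comp_stalkClosedPointTo {R : CommRingCat.{u}} [IsLocalRing R]
    {X : Scheme.{u}} (f : X ⟶ Spec R) (α : Spec R ⟶ X) (hα : α ≫ f = 𝟙 _) :
    stalkStructureMap f (α (IsLocalRing.closedPoint R)) ≫ Scheme.stalkClosedPointTo α = 𝟙 R := by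
  apply Spec.map_injective
  rw [Spec.map_comp, specMap_stalkStructureMap, ← Category.assoc,
    Scheme.Spec_stalkClosedPointTo_fromSpecStalk, hα, Spec.map_id]

/-- Near a smooth point in the fibre over the closed point of a local ring `R`, a scheme over `R` is
étale over an affine space. -/
theorem exists_etale_chart {R : CommRingCat.{u}} [IsLocalRing R] (X : Over (Spec R)) {x : X.left}
    (hx : X.hom x = IsLocalRing.closedPoint R) (hsm : LocalAut.IsSmoothAt X x) :
    ∃ (U : X.left.Opens) (_ : IsAffineOpen U) (hxU : x ∈ U) (d : ℕ)
      (φ : MvPolynomial (Fin d) R →+* Γ(X.left, U)), φ.Etale ∧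
      ((X.left.presheaf.germ U x hxU).hom.comp φ).comp MvPolynomial.C =
        (stalkStructureMap X.hom x).hom := by
  obtain ⟨V, hxV, hV⟩ := hsm
  -- an open subset of the base containing the closed point is everything
  obtain ⟨U₀, -, W, hW, hxW, hle, hstd⟩ := Smooth.exists_isStandardSmooth (V.ι ≫ X.hom) ⟨x, hxV⟩
  obtain rfl : U₀ = ⊤ := by
    have h1 : (V.ι ≫ X.hom) ⟨x, hxV⟩ ∈ U₀ := hle hxW
    have h2 : (V.ι ≫ X.hom) ⟨x, hxV⟩ = IsLocalRing.closedPoint R := hx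
    rw [h2] at h1
    exact IsLocalRing.closed_point_mem_iff.1 h1
  have hU : IsAffineOpen (V.ι ''ᵁ W) := hW.image_of_isOpenImmersion V.ι
  have hxU : x ∈ V.ι ''ᵁ W := ⟨⟨x, hxV⟩, hxW, rfl⟩
  let j : Γ(V.toScheme, W) ≅ Γ(X.left, V.ι ''ᵁ W) := (V.ι.appIso W).symm
  have hle' : V.ι ''ᵁ W ≤ X.hom ⁻¹ᵁ ⊤ := le_top
  have hj : (V.ι ≫ X.hom).appLE ⊤ W hle ≫ j.hom = X.hom.appLE ⊤ (V.ι ''ᵁ W) hle' := by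
    rw [Iso.symm_hom, Iso.comp_inv_eq, Scheme.Hom.appIso_hom', Scheme.Hom.appLE_comp_appLE]
  obtain ⟨d, φ, hφC, hφ⟩ := RingHom.IsStandardSmooth.exists_etale_mvPolynomial
    (f := j.hom.hom.comp (((V.ι ≫ X.hom).appLE ⊤ W hle).hom.comp (Scheme.ΓSpecIso R).inv.hom)) (by
      have hiso := RingHom.isStandardSmooth_respectsIso
      exact hiso.1 _ j.commRingCatIsoToRingEquiv
        (hiso.2 _ (Scheme.ΓSpecIso R).symm.commRingCatIsoToRingEquiv hstd))
  refine ⟨_, hU, hxU, d, φ, hφ, ?_⟩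
  rw [RingHom.comp_assoc, hφC]
  rw [← specMap_appLE_comp_germ X.hom hU hxU hle', ← hj]
  rfl

/-- At a smooth section of a scheme over a discrete valuation ring there are coordinates vanishing
along the section. -/
theorem exists_flat_coordinates_stalk {R : CommRingCat.{u}} [IsDomain R]
    [IsDiscreteValuationRing R] {ϖ : R} (hϖ : Irreducible ϖ) (X : Over (Spec R))
    (α : LocalAut.Points X)
    (hsm : LocalAut.IsSmoothAt X (α.left (IsLocalRing.closedPoint R))) :
    let x := α.left (IsLocalRing.closedPoint R)
    let A := X.left.presheaf.stalk x
    IsNoetherianRing A ∧ ∃ (d : ℕ) (ψ : MvPolynomial (Fin d) R →+* A),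
      ψ.comp MvPolynomial.C = (stalkStructureMap X.hom x).hom ∧ ψ.Flat ∧
      IsLocalRing.maximalIdeal A = (originIdeal ϖ d).map ψ ∧
      ∀ i, (Scheme.stalkClosedPointTo α.left).hom (ψ (MvPolynomial.X i)) = 0 := by
  intro x A
  have hα : α.left ≫ X.hom = 𝟙 _ := Over.w α
  have hx : X.hom x = IsLocalRing.closedPoint R := by
    change (α.left ≫ X.hom) (IsLocalRing.closedPoint R) = _
    rw [hα]
    rfl
  obtain ⟨U, hU, hxU, d, φ, hφ, hφR⟩ := exists_etale_chart X hx hsm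
  let _ : Algebra Γ(X.left, U) A := X.left.presheaf.algebra_section_stalk ⟨x, hxU⟩
  have : IsLocalization.AtPrime A (hU.primeIdealOf ⟨x, hxU⟩).asIdeal :=
    hU.isLocalization_stalk ⟨x, hxU⟩
  let _ : Algebra R A := (stalkStructureMap X.hom x).hom.toAlgebra
  obtain ⟨hN, ψ, h⟩ := exists_flat_coordinates hϖ (A := A) (hU.primeIdealOf ⟨x, hxU⟩).asIdeal φ hφ
    hφR (Scheme.stalkClosedPointTo α.left).hom
    (congrArg CommRingCat.Hom.hom (stalkStructureMap_comp_stalkClosedPointTo X.hom α.left hα))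
  exact ⟨hN, d, ψ, h⟩

end Stalk

/-! ### The generic fibre -/

section GenericFibre

/-- A flat scheme over a domain is integral if its generic fibre is: the inclusion of the generic
fibre is scheme-theoretically dominant. -/
theorem isIntegral_of_isIntegral_pullback {R F : CommRingCat.{u}} [IsDomain R] (j : R ⟶ F)
    (hj : Function.Injective j.hom) {X : Scheme.{u}} (f : X ⟶ Spec R) [Flat f]
    [IsIntegral (pullback f (Spec.map j))] : IsIntegral X := by
  have : IsDominant (Spec.map j) := ⟨by
    refine (PrimeSpectrum.denseRange_comap_iff_ker_le_nilRadical j.hom).2 ?_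
    rw [(RingHom.injective_iff_ker_eq_bot _).1 hj]
    exact bot_le⟩
  have : IsSchemeTheoreticallyDominant (Spec.map j) := .of_isDominant _
  let ι := pullback.fst f (Spec.map j)
  have : IsReduced X := IsSchemeTheoreticallyDominant.isReduced ι
  have hd : DenseRange ι := ι.denseRange
  have : IrreducibleSpace X := by
    have h1 : IsIrreducible (Set.range ι) := by
      rw [← Set.image_univ]
      exact (IrreducibleSpace.isIrreducible_univ _).image _ ι.continuous.continuousOn
    have h2 := h1.closure
    rw [hd.closure_range] at h2
    exact irreducibleSpace_def _ |>.2 h2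
  exact isIntegral_of_irreducibleSpace_of_isReduced X

/-- The spectrum of the base change to `F` of the local ring at a point embeds into the base change
of the scheme. -/
theorem ringKrullDim_stalk_tensorProduct_le {R F : Type u} [CommRing R] [CommRing F] [Algebra R F]
    {X : Scheme.{u}} (f : X ⟶ Spec (CommRingCat.of R)) (x : X)
    [Algebra R (X.presheaf.stalk x)]
    (hx : CommRingCat.ofHom (algebraMap R (X.presheaf.stalk x)) = stalkStructureMap f x) :
    ringKrullDim (TensorProduct R (X.presheaf.stalk x) F) ≤
      topologicalKrullDim ↥(pullback f (Spec.map (CommRingCat.ofHom (algebraMap R F)))) := by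
  have h1 := isPullback_SpecMap_of_isPushout _ _ _ _
    (CommRingCat.isPushout_tensorProduct R (X.presheaf.stalk x) F)
  have h2 : Spec.map (CommRingCat.ofHom (algebraMap R (X.presheaf.stalk x))) =
      X.fromSpecStalk x ≫ f := by
    rw [hx, specMap_stalkStructureMap]
  rw [h2] at h1
  have h3 := IsPullback.of_hasPullback f (Spec.map (CommRingCat.ofHom (algebraMap R F)))
  have w := h1.w
  rw [← Category.assoc] at w
  let l := h3.lift _ _ w
  have h4 : l ≫ pullback.snd _ _ = _ := h3.lift_snd _ _ w
  rw [← h4] at h1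
  have h5 := IsPullback.of_bot h1 (h3.lift_fst _ _ w).symm h3
  have : IsPreimmersion l := MorphismProperty.of_isPullback (P := @IsPreimmersion) h5 inferInstance
  have h6 := l.isEmbedding.isInducing.topologicalKrullDim_le
  rwa [← PrimeSpectrum.topologicalKrullDim_eq_ringKrullDim]

end GenericFibre

/-! ### Points of the special fibre -/

section SpecialFibre

/-- Points of a base change are points of the scheme over the morphism of bases. -/
noncomputable def pointsPullbackEquiv {S Z : Scheme.{u}} (X : Over S) (i : Z ⟶ S) :
    LocalAut.Points (Over.mk (pullback.snd X.hom i)) ≃ (Over.mk i ⟶ X) where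
  toFun γ := Over.homMk (γ.left ≫ pullback.fst X.hom i) (by
    have h := Over.w γ
    dsimp at h ⊢
    rw [Category.assoc, pullback.condition, ← Category.assoc, h, Category.id_comp])
  invFun β := Over.homMk (pullback.lift β.left (𝟙 Z) (by
    have h := Over.w β
    dsimp at h ⊢
    rw [h, Category.id_comp]))
    (by dsimp; exact pullback.lift_snd _ _ _)
  left_inv γ := by
    have h := Over.w γ
    dsimp at h
    apply Over.OverMorphism.ext
    apply pullback.hom_ext
    · exact pullback.lift_fst _ _ _
    · exact (pullback.lift_snd _ _ _).trans h.symm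
  right_inv β := Over.OverMorphism.ext (pullback.lift_fst _ _ _)

theorem finite_ringHom_of_finiteType {R B k : Type*} [CommRing R] [CommRing B] [CommRing k]
    [Finite k] {χ : R →+* B} (hχ : χ.FiniteType) (r : R →+* k) :
    Finite {ψ : B →+* k // ψ.comp χ = r} := by
  let _ : Algebra R B := χ.toAlgebra
  let _ : Algebra R k := r.toAlgebra
  obtain ⟨s, hs⟩ := hχ.out
  refine Finite.of_injective (β := s → k) (fun ψ b => ψ.1 b) fun ψ ψ' h => ?_
  let toAlg : {ψ : B →+* k // ψ.comp χ = r} → (B →ₐ[R] k) := fun ψ =>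
    { ψ.1 with commutes' := fun x => RingHom.congr_fun ψ.2 x }
  have h1 : toAlg ψ = toAlg ψ' := AlgHom.ext_of_adjoin_eq_top hs fun b hb => congrFun h ⟨b, hb⟩
  exact Subtype.ext (RingHom.ext fun b => AlgHom.congr_fun h1 b)

/-- A scheme of finite type has finitely many points with values in a given finite field. -/
theorem finite_over_hom {R k : CommRingCat.{u}} (hk : IsField k) [Finite k] (r : R ⟶ k)
    (X : Over (Spec R)) [LocallyOfFiniteType X.hom] [QuasiCompact X.hom] :
    Finite (Over.mk (Spec.map r) ⟶ X) := by
  have : CompactSpace X.left := (quasiCompact_iff_compactSpace X.hom).1 inferInstance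
  let 𝒰 := X.left.affineCover.finiteSubcover
  have hU : ∀ i : 𝒰.I₀, IsAffineOpen (𝒰.f i).opensRange := fun i => isAffineOpen_opensRange _
  let χ : ∀ i : 𝒰.I₀, R ⟶ Γ(X.left, (𝒰.f i).opensRange) := fun i =>
    (Scheme.ΓSpecIso R).inv ≫ X.hom.appLE ⊤ _ le_top
  have hχ : ∀ i, Spec.map (χ i) = (hU i).fromSpec ≫ X.hom := fun i =>
    specMap_ΓSpecIso_inv_appLE X.hom (hU i) le_top
  have hft : ∀ i, (χ i).hom.FiniteType := fun i =>
    RingHom.finiteType_respectsIso.2 _ (Scheme.ΓSpecIso R).symm.commRingCatIsoToRingEquiv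
      (X.hom.finiteType_appLE (isAffineOpen_top _) (hU i) le_top)
  have hfin : ∀ i, Finite {ψ : Γ(X.left, (𝒰.f i).opensRange) →+* k // ψ.comp (χ i).hom = r.hom} :=
    fun i => finite_ringHom_of_finiteType (hft i) r.hom
  let Θ : (Σ i, {ψ : Γ(X.left, (𝒰.f i).opensRange) →+* k // ψ.comp (χ i).hom = r.hom}) →
      (Over.mk (Spec.map r) ⟶ X) := fun t =>
    Over.homMk (Spec.map (CommRingCat.ofHom t.2.1) ≫ (hU t.1).fromSpec) (by
      have : χ t.1 ≫ CommRingCat.ofHom t.2.1 = r := CommRingCat.hom_ext t.2.2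
      dsimp
      rw [Category.assoc, ← hχ, ← Spec.map_comp, this])
  refine Finite.of_surjective Θ fun β => ?_
  let _ := hk.toField
  let pt : Spec k := IsLocalRing.closedPoint k
  have hpt : ∀ y : Spec k, y = pt := fun y => Subsingleton.elim (α := PrimeSpectrum k) y pt
  let i := 𝒰.idx (β.left pt)
  have hmem : β.left pt ∈ (𝒰.f i).opensRange := 𝒰.covers _
  have hrange : Set.range β.left ⊆ Set.range (hU i).fromSpec := by
    rw [(hU i).range_fromSpec]
    rintro _ ⟨y, rfl⟩
    rw [hpt y]
    exact hmem
  let l : Spec k ⟶ Spec Γ(X.left, (𝒰.f i).opensRange) :=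
    IsOpenImmersion.lift (hU i).fromSpec β.left hrange
  have hl : Spec.map (Spec.preimage l) ≫ (hU i).fromSpec = β.left := by
    rw [Spec.map_preimage]
    exact IsOpenImmersion.lift_fac _ _ _
  refine ⟨⟨i, (Spec.preimage l).hom, ?_⟩, Over.OverMorphism.ext hl⟩
  rw [← CommRingCat.hom_comp]
  congr 1
  apply Spec.map_injective
  rw [Spec.map_comp, hχ, ← Category.assoc, hl]
  exact Over.w β

end SpecialFibre

/-! ### The bound -/

section Bound

/-- The action of the automorphisms of `X` on the morphisms to `X`. -/
abbrev homMulAction {C : Type*} [Category C] (Y X : C) : MulAction (Aut X) (Y ⟶ X) where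
  smul σ β := β ≫ σ.hom
  one_smul β := Category.comp_id β
  mul_smul σ τ β := (Category.assoc β τ.hom σ.hom).symm

theorem finite_and_card_le_of_stabilizer {G T : Type*} [Group G] [MulAction G T] [Finite T] (t : T)
    [Finite (MulAction.stabilizer G t)] :
    Finite G ∧ Nat.card G ≤ Nat.card (MulAction.stabilizer G t) * Nat.card T := by
  have h1 := (MulAction.stabilizer G t).card_mul_index
  rw [MulAction.index_stabilizer] at h1
  have h2 : (MulAction.orbit G t).ncard ≠ 0 :=
    (Set.ncard_pos (Set.toFinite _)).2 (MulAction.nonempty_orbit t) |>.ne'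
  refine ⟨Nat.finite_of_card_ne_zero ?_, ?_⟩
  · rw [← h1]
    exact mul_ne_zero Nat.card_pos.ne' h2
  · rw [← h1]
    exact Nat.mul_le_mul_left _ (Set.ncard_le_card _)

theorem exponent_le {d g : ℕ} (hdg : d ≤ g) (e : ℕ) :
    d * (e + 1) * (d + e).choose d ≤ g * (1 + e) * (g + e + 1).choose g := by
  have h1 : (d + e).choose d ≤ (g + e + 1).choose g := by
    rw [Nat.choose_symm_add]
    refine (Nat.choose_le_choose e (Nat.add_le_add_right hdg e)).trans ?_
    rw [← Nat.choose_symm_add]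
    exact Nat.choose_le_choose g (Nat.le_succ _)
  rw [Nat.add_comm e 1]
  exact Nat.mul_le_mul (Nat.mul_le_mul_right _ hdg) h1

/-- The bound for torsion groups of automorphisms fixing the reduction of a smooth section, in terms
of the relative dimension `d` of the scheme along the section. -/
theorem exists_relative_dimension_and_card_le {R : CommRingCat.{u}} [IsDomain R]
    [IsDiscreteValuationRing R] [Finite (IsLocalRing.ResidueField R)] {ϖ : R}
    (hϖ : Irreducible ϖ) {p e : ℕ} (hp : p.Prime) (hp2 : 2 < p) (he : 1 ≤ e)
    (hpe : ∃ v : Rˣ, (p : R) = ϖ ^ e * v) (X : Over (Spec R)) [IsIntegral X.left]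
    [IsSeparated X.hom] (α : LocalAut.Points X)
    (hsm : LocalAut.IsSmoothAt X (α.left (IsLocalRing.closedPoint R)))
    {H : Type*} [Group H] (hH : IsMulTorsion H) (θ : H →* Aut X) (hθ : Function.Injective θ)
    (hfix : ∀ σ, (θ σ).hom.left (α.left (IsLocalRing.closedPoint R)) =
      α.left (IsLocalRing.closedPoint R)) (F : Type u) [Field F] [Algebra R F]
    [IsFractionRing R F] :
    ∃ d : ℕ, (d : WithBot ℕ∞) ≤
        topologicalKrullDim ↥(pullback X.hom (Spec.map (CommRingCat.ofHom (algebraMap R F)))) ∧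
      Finite H ∧ Nat.card H ≤
        Nat.card (IsLocalRing.ResidueField R) ^ (d * (e + 1) * (d + e).choose d) := by
  obtain ⟨hN, d, ψ, hψC, hψ, hmax, hεψ⟩ := exists_flat_coordinates_stalk hϖ X α hsm
  obtain ⟨ρ, hρ, hρR⟩ := exists_faithful_action_stalk X θ hθ hfix
  let x := α.left (IsLocalRing.closedPoint R)
  let _ : Algebra R (X.left.presheaf.stalk x) := (stalkStructureMap X.hom x).hom.toAlgebra
  let _ : Algebra (MvPolynomial (Fin d) R) (X.left.presheaf.stalk x) := ψ.toAlgebra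
  have : IsScalarTower R (MvPolynomial (Fin d) R) (X.left.presheaf.stalk x) :=
    .of_algebraMap_eq' hψC.symm
  have : Module.Flat (MvPolynomial (Fin d) R) (X.left.presheaf.stalk x) := hψ
  let ε : X.left.presheaf.stalk x →+* R := (Scheme.stalkClosedPointTo α.left).hom
  have hε : ε.comp (algebraMap R (X.left.presheaf.stalk x)) = RingHom.id R :=
    congrArg CommRingCat.Hom.hom
      (stalkStructureMap_comp_stalkClosedPointTo X.hom α.left (Over.w α))
  have hres : ∀ a : X.left.presheaf.stalk x, ∃ r : R,
      a - algebraMap R _ r ∈ IsLocalRing.maximalIdeal (X.left.presheaf.stalk x) := by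
    intro a
    refine ⟨ε a, fun hu => ?_⟩
    have h1 := hu.map ε
    rw [map_sub, ← RingHom.comp_apply ε, hε, RingHom.id_apply, sub_self] at h1
    exact not_isUnit_zero h1
  exact ⟨d, (le_ringKrullDim_tensorProduct (F := F) ψ hψC hψ ε hε hεψ).trans
      (ringKrullDim_stalk_tensorProduct_le X.hom x rfl),
    finite_and_card_le_of_isMulTorsion hp hp2 he hϖ hpe hmax hres hH ρ hρ hρR⟩

end Bound

theorem theorem3p1 (p : ℕ) [Fact p.Prime] (hp : 2 < p)
    (K : Type u) [NontriviallyNormedField K] [IsUltrametricDist K] [NormedAlgebra ℚ_[p] K]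
    [FiniteDimensional ℚ_[p] K]
    (𝒳 : Over (LocalAut.specIntegers K))
    [Flat 𝒳.hom] [IsSeparated 𝒳.hom] [LocallyOfFiniteType 𝒳.hom] [QuasiCompact 𝒳.hom]
    (g : ℕ)
    (hvar : LocalAut.IsVariety (LocalAut.genericFiber 𝒳))
    (hdim : topologicalKrullDim (LocalAut.genericFiber 𝒳).left = g)
    (hsmooth : ∃ α : LocalAut.Points 𝒳, LocalAut.IsSmoothPoint 𝒳 α)
    (G : Subgroup (Aut 𝒳)) (hG : IsMulTorsion G) :
    Finite G ∧
      Nat.card G ≤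
        Nat.card 𝓀[K] ^
            (g * (1 + LocalAut.ramificationIndex p K) *
              (g + LocalAut.ramificationIndex p K + 1).choose g) *
          Nat.card (Matrix.GeneralLinearGroup (Fin g) 𝓀[K]) *
          Nat.card (LocalAut.Points (LocalAut.specialFiber 𝒳)) := by
  have := isDiscreteValuationRing_integers p K
  have := finite_residueField_integers p K
  obtain ⟨ϖ, hϖ⟩ := IsDiscreteValuationRing.exists_irreducible 𝒪[K]
  obtain ⟨he, hpe⟩ := ramificationIndex_spec p K hϖ
  have : IsIntegral (pullback 𝒳.hom (LocalAut.specFraction K)) := hvar.isIntegral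
  have : IsIntegral 𝒳.left := isIntegral_of_isIntegral_pullback
    (CommRingCat.ofHom (Valued.integer K).subtype) Subtype.val_injective 𝒳.hom
  obtain ⟨α, hα⟩ := hsmooth
  let s : LocalAut.specIntegers K := IsLocalRing.closedPoint 𝒪[K]
  -- the stabilizer of the reduction of `α` in the set of points of the special fibre
  have : Finite (Over.mk (LocalAut.specResidue K) ⟶ 𝒳) :=
    finite_over_hom (Field.toIsField 𝓀[K]) _ 𝒳
  let _ : MulAction (Aut 𝒳) (Over.mk (LocalAut.specResidue K) ⟶ 𝒳) := homMulAction _ _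
  let β : Over.mk (LocalAut.specResidue K) ⟶ 𝒳 :=
    Over.homMk (V := Over.mk (𝟙 (LocalAut.specIntegers K))) (LocalAut.specResidue K)
      (Category.comp_id _) ≫ α
  let H := MulAction.stabilizer G β
  have hfix : ∀ σ : H, ((σ : G) : Aut 𝒳).hom.left (α.left s) = α.left s := by
    intro σ
    have h1 : LocalAut.specResidue K ≫ α.left ≫ ((σ : G) : Aut 𝒳).hom.left =
        LocalAut.specResidue K ≫ α.left :=
      (Category.assoc _ _ _).symm.trans
        (congrArg (fun γ : Over.mk (LocalAut.specResidue K) ⟶ 𝒳 => γ.left) σ.2)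
    have h2 : LocalAut.specResidue K (IsLocalRing.closedPoint 𝓀[K]) = s :=
      IsLocalRing.PrimeSpectrum.comap_residue 𝒪[K] _
    have h3 := congrArg (fun γ : Spec (CommRingCat.of 𝓀[K]) ⟶ 𝒳.left =>
      γ (IsLocalRing.closedPoint 𝓀[K])) h1
    rw [← h2]
    exact h3
  obtain ⟨d, hd, hHfin, hHcard⟩ := exists_relative_dimension_and_card_le
    (R := CommRingCat.of 𝒪[K]) hϖ (Fact.out : p.Prime) hp he hpe 𝒳 α (hα s) (hG.subgroup H)
    (G.subtype.comp H.subtype) (G.subtype_injective.comp H.subtype_injective) hfix K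
  have hdg : d ≤ g := by exact_mod_cast hd.trans hdim.le
  obtain ⟨hfin, hcard⟩ := finite_and_card_le_of_stabilizer (G := G) β
  refine ⟨hfin, hcard.trans ?_⟩
  rw [Nat.card_congr (pointsPullbackEquiv 𝒳 (LocalAut.specResidue K))]
  refine Nat.mul_le_mul_right _ (hHcard.trans ?_)
  -- the factor `#GL_g(k)` is only used to be at least one
  exact (Nat.pow_le_pow_right Nat.card_pos (exponent_le hdg _)).trans
    (Nat.le_mul_of_pos_right _ Nat.card_pos)
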